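/- Let $X$ and $Y$ be real or complex Hilbert spaces, and let $T : X \to Y$ be a bounded linear operator with $\|T^*T\| \le e^{-1}$. Let $p > 0$, $\rho > 0$, put $f_p(\lambda) = (-\ln\lambda)^{-p}$ for $0 < \lambda < 1$ and $f_p(0) = 0$, and let $$X_{f_p}(\rho) = \{ f_p(T^*T) w : w \in X,\ \|w\| \le \rho \}.$$ For $0 < \alpha < \infty$ let $g_\alpha(\lambda) = \dfrac{1}{\lambda + (1-\lambda^{\sqrt{\alpha}})^2}$ on $[0, \|T^*T\|]$, and for $\alpha = \infty$ let $g_\infty(\lambda) = \lim_{\alpha\to\infty} g_\alpha(\lambda) = \dfrac{1}{\lambda + 1}$. For $y^\delta \in Y$ put $x_\alpha^\delta = g_\alpha(T^*T) T^* y^\delta$ and, for $\delta > 0$, $$\alpha(\delta, y^\delta) = \sup\{ \alpha \in (0,\infty) : \|T x_\alpha^\delta - y^\delta\| \le \delta + \sqrt{\delta} \}, \qquad R(\delta) y^\delta = x_{\alpha(\delta,y^\delta)}^\delta .$$ Then the following hold. 1. The rule is well defined: if $x^\dagger \in X_{f_p}(\rho)$, $\delta > 0$ and $\|y^\delta - T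 x^\dagger\| \le \delta$, then the set in the supremum is nonempty, so $\alpha(\delta, y^\delta) \in (0, \infty]$. 2. For every $x^\dagger \in X_{f_p}(\rho)$ and every family $(y^\delta)_{\delta > 0}$ in $Y$ with $\|y^\delta - T x^\dagger\| \le \delta$ for all $\delta > 0$, the regularized solution $x(\delta) = R(\delta) y^\delta$ satisfies $$\|x^\dagger - x(\delta)\| = \mathcal{O}(f_p(\delta)) \quad \text{as } \delta \downarrow 0 .$$ 3. The method is order optimal under the logarithmic source condition: there is a constant $C \ge 1$ such that the worst case error satisfies $$\sup\{ \|R(\delta) y^\delta - x^\dagger\| : x^\dagger \in X_{f_p}(\rho),\ y^\delta \in Y,\ \|y^\delta - T x^\dagger\| \le \delta \} \le C \rho\, f_p(\delta^2/\rho^2)\,(1 + o(1)) \quad \text{as } \delta \downarrow 0 .$$ -/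

import Mathlib

open Filter Topology Set Asymptotics
open scoped ENNReal Polynomial

namespace LogReg

section Calculus

variable {𝕜 X : Type*} [RCLike 𝕜] [NormedAddCommGroup X] [InnerProductSpace 𝕜 X] [CompleteSpace X]

/-- The filter of real polynomials converging to `f` uniformly on `[0, M]`. -/
def polyFilter (f : ℝ → ℝ) (M : ℝ) : Filter ℝ[X] :=
  ⨅ ε ∈ Ioi (0 : ℝ), 𝓟 {q : ℝ[X] | ∀ l ∈ Icc (0 : ℝ) M, |q.eval l - f l| ≤ ε}

/-- The continuous functional calculus `f(A)` of a nonnegative self-adjoint bounded operator `A` on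
a real or complex Hilbert space: the limit, in operator norm, of `q(A)` as the real polynomials `q`
converge to `f` uniformly on `[0, ‖A‖]`. It is used only for `A = T* T` and for `f` continuous
on `[0, ‖A‖]`; for a complex space it agrees with Mathlib's `cfc f A`. -/
noncomputable def opFun (A : X →L[𝕜] X) (f : ℝ → ℝ) : X →L[𝕜] X :=
  limUnder (polyFilter f ‖A‖) fun q => Polynomial.aeval A (q.map (algebraMap ℝ 𝕜))

end Calculus

/-- The index function `f_p(λ) = (-ln λ)^(-p)`, for `p > 0` and `0 < λ < 1`; at `λ = 0` the value of
this expression is `0`, which is the limit as `λ ↓ 0`. -/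
noncomputable def logFun (p l : ℝ) : ℝ := (-Real.log l) ^ (-p)

/-- The generator function `g_α(λ) = 1 / (λ + (1 - λ^√α)²)` for `0 < α < ∞`; for `α = ∞` its
pointwise limit `1 / (λ + 1)` as `α → ∞`, for `0 ≤ λ < 1`. -/
noncomputable def genFun (α : ℝ≥0∞) (l : ℝ) : ℝ :=
  if α = ⊤ then 1 / (l + 1) else 1 / (l + (1 - l ^ √α.toReal) ^ 2)

section Regularization

variable {𝕜 X Y : Type*} [RCLike 𝕜]
  [NormedAddCommGroup X] [InnerProductSpace 𝕜 X] [CompleteSpace X]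
  [NormedAddCommGroup Y] [InnerProductSpace 𝕜 Y] [CompleteSpace Y]

/-- The operator `T* T`. -/
noncomputable def gram (T : X →L[𝕜] Y) : X →L[𝕜] X := T.adjoint.comp T

/-- The source set `{f_p(T* T) w : ‖w‖ ≤ ρ}`. -/
def sourceSet (T : X →L[𝕜] Y) (p ρ : ℝ) : Set X :=
  {x | ∃ w : X, ‖w‖ ≤ ρ ∧ x = opFun (gram T) (logFun p) w}

/-- The regularized solution `g_α(T* T) T* y`. -/
noncomputable def regSol (T : X →L[𝕜] Y) (α : ℝ≥0∞) (y : Y) : X :=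
  opFun (gram T) (genFun α) (T.adjoint y)

/-- The a-posteriori parameter `sup {α > 0 : ‖T x_α - y‖ ≤ δ + √δ}`, with values in `[0, ∞]`. -/
noncomputable def paramChoice (T : X →L[𝕜] Y) (δ : ℝ) (y : Y) : ℝ≥0∞ :=
  sSup {α : ℝ≥0∞ | 0 < α ∧ α < ⊤ ∧ ‖T (regSol T α y) - y‖ ≤ δ + √δ}

/-- The regularized solution with the a-posteriori parameter. -/
noncomputable def discrepancySol (T : X →L[𝕜] Y) (δ : ℝ) (y : Y) : X :=
  regSol T (paramChoice T δ y) y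

/-- The worst case error
`Δ(δ, R, M) = sup {‖R y - x‖ : x ∈ M, y ∈ Y, ‖y - T x‖ ≤ δ}`, with values in `[0, ∞]`. -/
noncomputable def worstCaseError (T : X →L[𝕜] Y) (δ : ℝ) (R : Y → X) (M : Set X) : ℝ≥0∞ :=
  ⨆ x ∈ M, ⨆ y : Y, ⨆ _ : ‖y - T x‖ ≤ δ, ENNReal.ofReal ‖R y - x‖

/-- Order optimality of the method `R(δ) : Y → X` under the logarithmic source condition:
`Δ(δ, R(δ), X_{f_p}(ρ)) ≤ C ρ f_p(δ² / ρ²) (1 + o(1))` as `δ ↓ 0`, for some constant `C`. -/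
def IsOrderOptimalLog (T : X →L[𝕜] Y) (p ρ : ℝ) (R : ℝ → Y → X) : Prop :=
  ∃ C : ℝ, 1 ≤ C ∧ ∃ o : ℝ → ℝ, Tendsto o (𝓝[>] 0) (𝓝 0) ∧
    ∀ᶠ δ in 𝓝[>] (0 : ℝ), worstCaseError T δ (R δ) (sourceSet T p ρ) ≤
      ENNReal.ofReal (C * ρ * logFun p (δ ^ 2 / ρ ^ 2) * (1 + o δ))

end Regularization

end LogReg

/-!
For a positive operator `A` such as `T* T`, the norm of `q(A)`, `q` a real polynomial, is at most
the supremum of `|q|` over `[0, ‖A‖]` (`norm_polyOp_le`). If `‖q(A)‖` exceeded that supremum, then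
`q² - ‖q(A)‖²` would have no zero on `[0, ‖A‖]`, hence would be invertible at `A` by factoring over
`ℝ` (`isUnit_polyOp`), although `‖q(A)‖²` is an approximate eigenvalue of `q(A)²`
(`not_isUnit_sq_sub`). This argument works over real and complex scalars alike. By the Weierstrass
theorem the calculus extends to continuous functions as a monotone homomorphism, and
`‖T f(A) w‖ = ‖(√λ f)(A) w‖`.

Write `r_α = 1 - λ g_α`, `s = √α`, `x = f_p(A) w` and `z = y - T x`. The error splits into the bias
`r_α(A) x` and the noise `g_α(A) T* z`, and the residual `y - T x_α` is a contraction of `z` plus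
`T r_α(A) x`.

* Since `√λ r_α(λ) ≤ min(√λ, -s ln λ)`, the exact-data part of the residual is at most a multiple of
  `s^(3/4)` (`sqrt_mul_resFun_pow_le`). It vanishes as `α → 0`, so the rule is well defined; and as
  the discrepancy exceeds `δ + √δ` above the supremum, the chosen `s` is at least a multiple of
  `δ^(2/3)` (`sq_le_of_paramChoice_ne_top`).
* The noise is at most `δ sup √λ g_α ≤ δ (1 + 1 / s)`, hence a power of `δ` (`norm_noise_le`).
* The map `α ↦ g_α(A)` is norm continuous on `(0, ∞]` (`tendsto_opFun_genFun`), so the discrepancy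
  inequality holds at the supremum, and `‖T r_α(A) x‖ = O(√δ)`. As `f_p` is increasing,
  `f_p² ≤ f_p(ε)² + λ f_p² / ε`; with `ε = √δ` this conditional stability estimate
  (`norm_sq_opFun_logFun_le`) bounds the bias by a multiple of `f_p(√δ) = 2^p f_p(δ)` plus a power of
  `δ` (`norm_bias_le`).

Powers of `δ` are negligible against `f_p(δ)`, so the total error is `O(f_p(δ))` uniformly over the
source set and the data, and `f_p(δ)` is of the order of `f_p(δ² / ρ²)`.
-/

namespace LogReg

/-! ### Real polynomials of a positive operator -/

section PolynomialCalculus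

variable {𝕜 X : Type*} [RCLike 𝕜] [NormedAddCommGroup X] [InnerProductSpace 𝕜 X]

/-- Evaluation `q ↦ q(A)` of real polynomials at a bounded operator, as a ring homomorphism. -/
noncomputable def polyOp (A : X →L[𝕜] X) : ℝ[X] →+* (X →L[𝕜] X) :=
  (Polynomial.aeval A : 𝕜[X] →ₐ[𝕜] (X →L[𝕜] X)).toRingHom.comp
    (Polynomial.mapRingHom (algebraMap ℝ 𝕜))

lemma polyOp_apply (A : X →L[𝕜] X) (q : ℝ[X]) :
    polyOp A q = Polynomial.aeval A (q.map (algebraMap ℝ 𝕜)) := rfl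

@[simp] lemma polyOp_X (A : X →L[𝕜] X) : polyOp A Polynomial.X = A := by
  simp [polyOp_apply]

lemma polyOp_C_apply (A : X →L[𝕜] X) (c : ℝ) (x : X) :
    polyOp A (Polynomial.C c) x = (c : 𝕜) • x := by
  simp [polyOp_apply, Algebra.algebraMap_eq_smul_one]

variable [CompleteSpace X]

lemma isSelfAdjoint_polyOp {A : X →L[𝕜] X} (hA : IsSelfAdjoint A) (q : ℝ[X]) :
    IsSelfAdjoint (polyOp A q) := by
  induction q using Polynomial.induction_on' with
  | add p q hp hq => rw [map_add]; exact hp.add hq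
  | monomial n a =>
    rw [polyOp_apply, Polynomial.map_monomial, Polynomial.aeval_monomial,
      ← Algebra.smul_def]
    refine IsSelfAdjoint.smul ?_ (hA.pow n)
    simp [isSelfAdjoint_iff]

lemma isUnit_of_coercive {B : X →L[𝕜] X} {c : ℝ} (hc : 0 < c)
    (h : ∀ x, c * ‖x‖ ^ 2 ≤ |RCLike.re (inner 𝕜 (B x) x)|) : IsUnit B := by
  refine ContinuousLinearMap.isUnit_of_forall_le_norm_inner_map B (c := ⟨c, hc.le⟩) hc fun x => ?_
  rw [mul_comm]
  exact (h x).trans (RCLike.abs_re_le_norm _)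

variable {A : X →L[𝕜] X}

lemma isUnit_polyOp_X_sub_C (hA : A.IsPositive) {a : ℝ} (ha : a ∉ Icc 0 ‖A‖) :
    IsUnit (polyOp A (Polynomial.X - Polynomial.C a)) := by
  have key : ∀ x, RCLike.re (inner 𝕜 (polyOp A (Polynomial.X - Polynomial.C a) x) x) =
      RCLike.re (inner 𝕜 (A x) x) - a * ‖x‖ ^ 2 := by
    intro x
    rw [map_sub, sub_apply, inner_sub_left, polyOp_X, polyOp_C_apply,
      inner_smul_left, RCLike.conj_ofReal, map_sub, RCLike.re_ofReal_mul, inner_self_eq_norm_sq]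
  have h0 : ∀ x, 0 ≤ RCLike.re (inner 𝕜 (A x) x) := fun x => hA.re_inner_nonneg_left x
  have h1 : ∀ x, RCLike.re (inner 𝕜 (A x) x) ≤ ‖A‖ * ‖x‖ ^ 2 := fun x => by
    refine (re_inner_le_norm (A x) x).trans ?_
    nlinarith [A.le_opNorm x, norm_nonneg x]
  rcases lt_or_ge a 0 with h | h
  · refine isUnit_of_coercive (c := -a) (by linarith) fun x => ?_
    rw [key]
    refine le_trans ?_ (le_abs_self _)
    linarith [h0 x]
  · have h' : ‖A‖ < a := by
      by_contra hh
      exact ha ⟨h, not_lt.1 hh⟩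
    refine isUnit_of_coercive (c := a - ‖A‖) (by linarith) fun x => ?_
    rw [key]
    refine le_trans ?_ (neg_le_abs _)
    linarith [h1 x]

lemma isUnit_polyOp_quadratic (hA : IsSelfAdjoint A) (a : ℝ) {b : ℝ} (hb : b ≠ 0) :
    IsUnit (polyOp A ((Polynomial.X - Polynomial.C a) ^ 2 + Polynomial.C (b ^ 2))) := by
  refine isUnit_of_coercive (c := b ^ 2) (by positivity) fun x => ?_
  set B := polyOp A (Polynomial.X - Polynomial.C a) with hB
  have hBs : B.adjoint = B := isSelfAdjoint_polyOp hA _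
  have key : RCLike.re (inner 𝕜 (polyOp A
      ((Polynomial.X - Polynomial.C a) ^ 2 + Polynomial.C (b ^ 2)) x) x) =
      ‖B x‖ ^ 2 + b ^ 2 * ‖x‖ ^ 2 := by
    rw [map_add, add_apply, inner_add_left, map_pow, polyOp_C_apply,
      inner_smul_left, RCLike.conj_ofReal, map_add, RCLike.re_ofReal_mul, inner_self_eq_norm_sq,
      ← hB, pow_two B]
    congr 1
    rw [mul_apply_eq_comp, ← ContinuousLinearMap.adjoint_inner_right, hBs,
      inner_self_eq_norm_sq]
  rw [key]
  refine le_trans ?_ (le_abs_self _)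
  nlinarith [sq_nonneg ‖B x‖]

/-- Spectral inclusion for real polynomials: over `ℝ`, such a polynomial splits into linear factors
with roots outside `[0, ‖A‖]` and positive definite quadratic factors; each of these is coercive,
up to sign, at `A`. -/
lemma isUnit_polyOp (hA : A.IsPositive) (q : ℝ[X]) (hq : ∀ l ∈ Icc 0 ‖A‖, q.eval l ≠ 0) :
    IsUnit (polyOp A q) := by
  induction hn : q.natDegree using Nat.strong_induction_on generalizing q with
  | _ n ih =>
    have hq0 : q ≠ 0 := by
      rintro rfl
      exact hq 0 ⟨le_rfl, norm_nonneg _⟩ (by simp)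
    -- a factor of positive degree whose value at `A` is a unit can be split off
    have split : ∀ d e : ℝ[X], q = d * e → 0 < d.natDegree → IsUnit (polyOp A d) →
        IsUnit (polyOp A q) := by
      intro d e hde hd hu
      have hd0 : d ≠ 0 := by rintro rfl; simp at hd
      have he0 : e ≠ 0 := by rintro rfl; simp [hq0] at hde
      rw [hde, map_mul]
      refine hu.mul (ih e.natDegree ?_ e ?_ rfl)
      · rw [← hn, hde, Polynomial.natDegree_mul hd0 he0]; omega
      · intro l hl h
        exact hq l hl (by rw [hde, Polynomial.eval_mul, h, mul_zero])
    rcases Nat.eq_zero_or_pos q.natDegree with h0 | hpos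
    · rw [Polynomial.eq_C_of_natDegree_eq_zero h0] at hq0 ⊢
      have : IsUnit (Polynomial.C (q.coeff 0)) :=
        Polynomial.isUnit_C.2 (isUnit_iff_ne_zero.2 (by simpa using hq0))
      exact this.map (polyOp A)
    · obtain ⟨z, hz⟩ := IsAlgClosed.exists_aeval_eq_zero ℂ q
        (Polynomial.degree_ne_of_natDegree_ne hpos.ne')
      by_cases him : z.im = 0
      · have hzr : z = (z.re : ℂ) := by apply Complex.ext <;> simp [him]
        have hroot : q.IsRoot z.re := by
          rw [hzr] at hz
          have h2 := Polynomial.aeval_algebraMap_apply ℂ z.re q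
          rw [Complex.coe_algebraMap, hz] at h2
          have h3 : Polynomial.aeval z.re q = 0 := by exact_mod_cast h2.symm
          simpa [Polynomial.IsRoot] using h3
        obtain ⟨e, he⟩ := Polynomial.dvd_iff_isRoot.2 hroot
        refine split _ e he (by simp) (isUnit_polyOp_X_sub_C hA fun hmem => hq _ hmem hroot)
      · obtain ⟨e, he⟩ := q.quadratic_dvd_of_aeval_eq_zero_im_ne_zero hz him
        have hquad : (Polynomial.X ^ 2 - Polynomial.C (2 * z.re) * Polynomial.X +
            Polynomial.C (‖z‖ ^ 2) : ℝ[X]) =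
            (Polynomial.X - Polynomial.C z.re) ^ 2 + Polynomial.C (z.im ^ 2) := by
          rw [← Complex.normSq_eq_norm_sq, Complex.normSq_apply]
          simp only [map_add, map_mul, map_pow, Polynomial.C_ofNat]
          ring
        refine split _ e he ?_ ?_
        · rw [hquad, Polynomial.natDegree_add_C, Polynomial.natDegree_pow,
            Polynomial.natDegree_X_sub_C]
          norm_num
        · rw [hquad]
          exact isUnit_polyOp_quadratic hA.isSelfAdjoint _ him

/-- For self-adjoint `B`, the number `‖B‖²` is an approximate eigenvalue of `B²`. -/
lemma not_isUnit_sq_sub {B : X →L[𝕜] X} (hB : IsSelfAdjoint B) (hB0 : 0 < ‖B‖)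
    {D : X →L[𝕜] X} (hD : ∀ x, D x = B (B x) - ((‖B‖ ^ 2 : ℝ) : 𝕜) • x) : ¬ IsUnit D := by
  intro hu
  obtain ⟨U, hU⟩ := hu.exists_left_inv
  set b := ‖B‖ with hb
  have h1 : ∀ x, ‖D x‖ ^ 2 ≤ b ^ 2 * (b ^ 2 * ‖x‖ ^ 2 - ‖B x‖ ^ 2) := by
    intro x
    have e1 : RCLike.re (inner 𝕜 (B (B x)) (((b ^ 2 : ℝ) : 𝕜) • x)) = b ^ 2 * ‖B x‖ ^ 2 := by
      have hBs : B.adjoint = B := hB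
      rw [inner_smul_right, RCLike.re_ofReal_mul, ← ContinuousLinearMap.adjoint_inner_right, hBs,
        inner_self_eq_norm_sq]
    have e2 : ‖((b ^ 2 : ℝ) : 𝕜) • x‖ = b ^ 2 * ‖x‖ := by
      rw [norm_smul, RCLike.norm_ofReal, abs_of_nonneg (by positivity)]
    rw [hD, @norm_sub_sq 𝕜, e1, e2]
    have h2 : ‖B (B x)‖ ^ 2 ≤ b ^ 2 * ‖B x‖ ^ 2 := by
      rw [← mul_pow]
      exact pow_le_pow_left₀ (norm_nonneg _) (B.le_opNorm _) 2
    nlinarith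
  -- the summand `1` keeps `k` positive also if `U = 0`
  set k := ‖U‖ ^ 2 * b ^ 2 + 1 with hk
  have hkpos : 0 < k := by positivity
  have h2 : ∀ x, ‖B x‖ ^ 2 ≤ (b ^ 2 - 1 / k) * ‖x‖ ^ 2 := by
    intro x
    have hx : U (D x) = x := by
      rw [← mul_apply_eq_comp, hU]; rfl
    have h3 : ‖x‖ ^ 2 ≤ ‖U‖ ^ 2 * ‖D x‖ ^ 2 := by
      conv_lhs => rw [← hx]
      rw [← mul_pow]
      exact pow_le_pow_left₀ (norm_nonneg _) (U.le_opNorm _) 2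
    have h4 : 0 ≤ b ^ 2 * ‖x‖ ^ 2 - ‖B x‖ ^ 2 := by
      rw [← mul_pow]
      exact sub_nonneg.2 (pow_le_pow_left₀ (norm_nonneg _) (B.le_opNorm _) 2)
    have h5 : ‖x‖ ^ 2 ≤ k * (b ^ 2 * ‖x‖ ^ 2 - ‖B x‖ ^ 2) := by
      have := mul_le_mul_of_nonneg_left (h1 x) (sq_nonneg ‖U‖)
      rw [hk]; nlinarith
    have h6 : ‖x‖ ^ 2 / k ≤ b ^ 2 * ‖x‖ ^ 2 - ‖B x‖ ^ 2 := by
      rwa [div_le_iff₀' hkpos]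
    have : (b ^ 2 - 1 / k) * ‖x‖ ^ 2 = b ^ 2 * ‖x‖ ^ 2 - ‖x‖ ^ 2 / k := by ring
    linarith
  have h3 : ‖B‖ ≤ √(b ^ 2 - 1 / k) := by
    refine B.opNorm_le_bound (Real.sqrt_nonneg _) fun x => ?_
    rw [← Real.sqrt_sq (norm_nonneg (B x)), ← Real.sqrt_sq (norm_nonneg x),
      ← Real.sqrt_mul' _ (sq_nonneg _)]
    exact Real.sqrt_le_sqrt (h2 x)
  have h4 : √(b ^ 2 - 1 / k) < b := by
    rw [Real.sqrt_lt' hB0]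
    have : 0 < 1 / k := by positivity
    linarith
  linarith

lemma norm_polyOp_le (hA : A.IsPositive) (q : ℝ[X]) {K : ℝ}
    (hq : ∀ l ∈ Icc 0 ‖A‖, |q.eval l| ≤ K) : ‖polyOp A q‖ ≤ K := by
  by_contra hlt
  rw [not_le] at hlt
  have hK : 0 ≤ K := (abs_nonneg _).trans (hq 0 ⟨le_rfl, norm_nonneg _⟩)
  refine not_isUnit_sq_sub (isSelfAdjoint_polyOp hA.isSelfAdjoint q) (hK.trans_lt hlt)
    (D := polyOp A (q * q - Polynomial.C (‖polyOp A q‖ ^ 2))) (fun x => ?_)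
    (isUnit_polyOp hA _ fun l hl => ?_)
  · rw [map_sub, sub_apply, polyOp_C_apply, map_mul,
      mul_apply_eq_comp]
  · have h1 := hq l hl
    have h2 : q.eval l ^ 2 ≤ K ^ 2 := by
      rw [← sq_abs]; exact pow_le_pow_left₀ (abs_nonneg _) h1 2
    have h3 : K ^ 2 < ‖polyOp A q‖ ^ 2 := pow_lt_pow_left₀ hlt hK (by norm_num)
    simp only [Polynomial.eval_sub, Polynomial.eval_mul, Polynomial.eval_C]
    nlinarith

end PolynomialCalculus

/-! ### The continuous functional calculus -/

section ContinuousCalculus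

lemma hasBasis_polyFilter (f : ℝ → ℝ) (M : ℝ) :
    (polyFilter f M).HasBasis (fun ε : ℝ => ε ∈ Ioi (0 : ℝ))
      fun ε => {q : ℝ[X] | ∀ l ∈ Icc (0 : ℝ) M, |q.eval l - f l| ≤ ε} := by
  refine hasBasis_biInf_principal (fun a ha b hb => ⟨min a b, lt_min (mem_Ioi.1 ha) hb, ?_, ?_⟩)
    ⟨1, mem_Ioi.2 one_pos⟩
  · exact fun q hq l hl => (hq l hl).trans (min_le_left _ _)
  · exact fun q hq l hl => (hq l hl).trans (min_le_right _ _)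

lemma polyFilter_neBot {f : ℝ → ℝ} {M : ℝ} (hf : ContinuousOn f (Icc 0 M)) :
    (polyFilter f M).NeBot := by
  refine (hasBasis_polyFilter f M).neBot_iff.2 fun {ε} hε => ?_
  obtain ⟨q, hq⟩ := exists_polynomial_near_of_continuousOn 0 M f hf ε hε
  exact ⟨q, fun l hl => (hq l hl).le⟩

variable {𝕜 X : Type*} [RCLike 𝕜] [NormedAddCommGroup X] [InnerProductSpace 𝕜 X] [CompleteSpace X]
  {A : X →L[𝕜] X} {f g h : ℝ → ℝ}

lemma tendsto_polyOp_polyFilter (hA : A.IsPositive) (hf : ContinuousOn f (Icc 0 ‖A‖)) :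
    Tendsto (polyOp A) (polyFilter f ‖A‖) (𝓝 (opFun A f)) := by
  have := polyFilter_neBot hf
  refine tendsto_nhds_limUnder (cauchy_map_iff_exists_tendsto.1 ?_)
  refine Metric.cauchy_iff.2 ⟨inferInstance, fun ε hε => ?_⟩
  refine ⟨_, image_mem_map ((hasBasis_polyFilter f ‖A‖).mem_of_mem
    (i := ε / 3) (by simp only [mem_Ioi]; positivity)), ?_⟩
  rintro _ ⟨q, hq, rfl⟩ _ ⟨r, hr, rfl⟩
  rw [dist_eq_norm, ← map_sub]
  refine (norm_polyOp_le hA _ (K := ε / 3 + ε / 3) fun l hl => ?_).trans_lt (by linarith)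
  have h1 := abs_le.1 (hq l hl)
  have h2 := abs_le.1 (hr l hl)
  rw [Polynomial.eval_sub, abs_le]
  constructor <;> linarith [h1.1, h1.2, h2.1, h2.2]

lemma tendsto_opFun_of_tendstoUniformlyOn (hA : A.IsPositive) (hf : ContinuousOn f (Icc 0 ‖A‖))
    {q : ℕ → ℝ[X]} (hq : TendstoUniformlyOn (fun n l => (q n).eval l) f atTop (Icc 0 ‖A‖)) :
    Tendsto (fun n => polyOp A (q n)) atTop (𝓝 (opFun A f)) := by
  refine (tendsto_polyOp_polyFilter hA hf).comp ?_
  refine (hasBasis_polyFilter f ‖A‖).tendsto_right_iff.2 fun ε hε => ?_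
  filter_upwards [Metric.tendstoUniformlyOn_iff.1 hq ε hε] with n hn l hl
  have := hn l hl
  rw [dist_comm, Real.dist_eq] at this
  exact this.le

lemma exists_tendsto_opFun (hA : A.IsPositive) (hf : ContinuousOn f (Icc 0 ‖A‖)) :
    ∃ q : ℕ → ℝ[X], TendstoUniformlyOn (fun n l => (q n).eval l) f atTop (Icc 0 ‖A‖) ∧
      Tendsto (fun n => polyOp A (q n)) atTop (𝓝 (opFun A f)) := by
  have hpos : ∀ n : ℕ, (0 : ℝ) < 1 / ((n : ℝ) + 1) := fun n => by positivity
  choose q hq using fun n : ℕ =>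
    exists_polynomial_near_of_continuousOn 0 ‖A‖ f hf (1 / ((n : ℝ) + 1)) (hpos n)
  have hu : TendstoUniformlyOn (fun n l => (q n).eval l) f atTop (Icc 0 ‖A‖) := by
    refine Metric.tendstoUniformlyOn_iff.2 fun ε hε => ?_
    filter_upwards [tendsto_one_div_add_atTop_nhds_zero_nat.eventually (gt_mem_nhds hε)]
      with n hn l hl
    rw [dist_comm, Real.dist_eq]
    exact (hq n l hl).trans hn
  exact ⟨q, hu, tendsto_opFun_of_tendstoUniformlyOn hA hf hu⟩

lemma opFun_add (hA : A.IsPositive) (hf : ContinuousOn f (Icc 0 ‖A‖))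
    (hg : ContinuousOn g (Icc 0 ‖A‖)) :
    opFun A (fun l => f l + g l) = opFun A f + opFun A g := by
  obtain ⟨q, hq, hq'⟩ := exists_tendsto_opFun hA hf
  obtain ⟨r, hr, hr'⟩ := exists_tendsto_opFun hA hg
  have h1 := tendsto_opFun_of_tendstoUniformlyOn hA (f := fun l => f l + g l) (hf.fun_add hg)
    (q := fun n => q n + r n) (by simp only [Polynomial.eval_add]; exact hq.add hr)
  simp only [map_add] at h1
  exact tendsto_nhds_unique h1 (hq'.add hr')

lemma opFun_sub (hA : A.IsPositive) (hf : ContinuousOn f (Icc 0 ‖A‖))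
    (hg : ContinuousOn g (Icc 0 ‖A‖)) :
    opFun A (fun l => f l - g l) = opFun A f - opFun A g := by
  have := opFun_add hA (hf.fun_sub hg) hg
  rw [eq_sub_iff_add_eq, ← this]
  simp

lemma opFun_mul (hA : A.IsPositive) (hf : ContinuousOn f (Icc 0 ‖A‖))
    (hg : ContinuousOn g (Icc 0 ‖A‖)) :
    opFun A (fun l => f l * g l) = opFun A f * opFun A g := by
  obtain ⟨q, hq, hq'⟩ := exists_tendsto_opFun hA hf
  obtain ⟨r, hr, hr'⟩ := exists_tendsto_opFun hA hg
  have hu : TendstoUniformlyOn (fun n l => (q n * r n).eval l) (fun l => f l * g l) atTop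
      (Icc 0 ‖A‖) := by
    rw [← tendstoLocallyUniformlyOn_iff_tendstoUniformlyOn_of_compact isCompact_Icc] at hq hr ⊢
    simp only [Polynomial.eval_mul]
    exact hq.mul₀ hr hf hg
  have h1 := tendsto_opFun_of_tendstoUniformlyOn hA (hf.fun_mul hg) hu
  simp only [map_mul] at h1
  exact tendsto_nhds_unique h1 (hq'.mul hr')

lemma opFun_id (hA : A.IsPositive) : opFun A (fun l => l) = A := by
  have h1 := tendsto_opFun_of_tendstoUniformlyOn hA (f := fun l => l) continuousOn_id
    (q := fun _ => Polynomial.X) (by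
      refine Metric.tendstoUniformlyOn_iff.2 fun ε hε => Eventually.of_forall fun n l _ => ?_
      simpa using hε)
  simp only [polyOp_X] at h1
  exact tendsto_nhds_unique h1 tendsto_const_nhds

lemma opFun_one (hA : A.IsPositive) : opFun A (fun _ => 1) = 1 := by
  have h1 := tendsto_opFun_of_tendstoUniformlyOn hA (f := fun _ => 1) continuousOn_const
    (q := fun _ => 1) (by
      refine Metric.tendstoUniformlyOn_iff.2 fun ε hε => Eventually.of_forall fun n l _ => ?_
      simpa using hε)
  simp only [map_one] at h1
  exact tendsto_nhds_unique h1 tendsto_const_nhds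

lemma isSelfAdjoint_opFun (hA : A.IsPositive) (hf : ContinuousOn f (Icc 0 ‖A‖)) :
    IsSelfAdjoint (opFun A f) := by
  obtain ⟨q, -, hq⟩ := exists_tendsto_opFun hA hf
  have h1 := (continuous_star.tendsto (opFun A f)).comp hq
  refine tendsto_nhds_unique (h1.congr fun n => ?_) hq
  exact (isSelfAdjoint_polyOp hA.isSelfAdjoint (q n))

lemma norm_opFun_le (hA : A.IsPositive) (hf : ContinuousOn f (Icc 0 ‖A‖)) {K : ℝ}
    (hK : ∀ l ∈ Icc 0 ‖A‖, |f l| ≤ K) : ‖opFun A f‖ ≤ K := by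
  obtain ⟨q, hu, hq⟩ := exists_tendsto_opFun hA hf
  refine le_of_forall_pos_le_add fun ε hε => ?_
  refine le_of_tendsto hq.norm ?_
  filter_upwards [Metric.tendstoUniformlyOn_iff.1 hu ε hε] with n hn
  refine norm_polyOp_le hA _ fun l hl => ?_
  have h1 := hn l hl
  rw [dist_comm, Real.dist_eq] at h1
  calc |(q n).eval l| = |((q n).eval l - f l) + f l| := by ring_nf
    _ ≤ |(q n).eval l - f l| + |f l| := abs_add_le _ _
    _ ≤ K + ε := by linarith [hK l hl]

lemma opFun_congr (hA : A.IsPositive) (hf : ContinuousOn f (Icc 0 ‖A‖))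
    (hfg : ∀ l ∈ Icc 0 ‖A‖, f l = g l) : opFun A f = opFun A g := by
  have hg : ContinuousOn g (Icc 0 ‖A‖) := hf.congr fun l hl => (hfg l hl).symm
  rw [← sub_eq_zero, ← opFun_sub hA hf hg, ← norm_le_zero_iff]
  exact norm_opFun_le hA (hf.fun_sub hg) fun l hl => by simp [hfg l hl]

lemma re_inner_opFun_mul_self (hA : A.IsPositive) (hf : ContinuousOn f (Icc 0 ‖A‖)) (w : X) :
    RCLike.re (inner 𝕜 (opFun A (fun l => f l * f l) w) w) = ‖opFun A f w‖ ^ 2 := by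
  have hs : (opFun A f).adjoint = opFun A f := isSelfAdjoint_opFun hA hf
  rw [opFun_mul hA hf hf, mul_apply_eq_comp, ← ContinuousLinearMap.adjoint_inner_right, hs,
    inner_self_eq_norm_sq]

lemma re_inner_opFun_nonneg (hA : A.IsPositive) (hf : ContinuousOn f (Icc 0 ‖A‖))
    (h0 : ∀ l ∈ Icc 0 ‖A‖, 0 ≤ f l) (w : X) :
    0 ≤ RCLike.re (inner 𝕜 (opFun A f w) w) := by
  rw [opFun_congr (g := fun l => √(f l) * √(f l)) hA hf
    fun l hl => (Real.mul_self_sqrt (h0 l hl)).symm, re_inner_opFun_mul_self hA hf.sqrt]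
  positivity

lemma re_inner_opFun_mono (hA : A.IsPositive) (hf : ContinuousOn f (Icc 0 ‖A‖))
    (hg : ContinuousOn g (Icc 0 ‖A‖)) (hfg : ∀ l ∈ Icc 0 ‖A‖, f l ≤ g l) (w : X) :
    RCLike.re (inner 𝕜 (opFun A f w) w) ≤ RCLike.re (inner 𝕜 (opFun A g w) w) := by
  have := re_inner_opFun_nonneg hA (hg.fun_sub hf) (fun l hl => sub_nonneg.2 (hfg l hl)) w
  change 0 ≤ RCLike.re (inner 𝕜 (opFun A (fun l => g l - f l) w) w) at this
  rw [opFun_sub hA hg hf, sub_apply, inner_sub_left, map_sub] at this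
  linarith

lemma norm_sq_opFun_apply_le (hA : A.IsPositive) (hf : ContinuousOn f (Icc 0 ‖A‖))
    (hg : ContinuousOn g (Icc 0 ‖A‖)) (hh : ContinuousOn h (Icc 0 ‖A‖))
    (hfgh : ∀ l ∈ Icc 0 ‖A‖, f l ^ 2 ≤ g l ^ 2 + h l ^ 2) (w : X) :
    ‖opFun A f w‖ ^ 2 ≤ ‖opFun A g w‖ ^ 2 + ‖opFun A h w‖ ^ 2 := by
  have := re_inner_opFun_mono hA (hf.fun_mul hf) ((hg.fun_mul hg).fun_add (hh.fun_mul hh))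
    (fun l hl => by simpa only [pow_two] using hfgh l hl) w
  change RCLike.re (inner 𝕜 (opFun A (fun l => f l * f l) w) w) ≤
    RCLike.re (inner 𝕜 (opFun A (fun l => g l * g l + h l * h l) w) w) at this
  rw [opFun_add hA (hg.fun_mul hg) (hh.fun_mul hh), add_apply, inner_add_left, map_add] at this
  simpa only [re_inner_opFun_mul_self hA hf, re_inner_opFun_mul_self hA hg,
    re_inner_opFun_mul_self hA hh] using this

end ContinuousCalculus

section Gram

variable {𝕜 X Y : Type*} [RCLike 𝕜]
  [NormedAddCommGroup X] [InnerProductSpace 𝕜 X] [CompleteSpace X]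
  [NormedAddCommGroup Y] [InnerProductSpace 𝕜 Y] [CompleteSpace Y]
  {T : X →L[𝕜] Y} {f : ℝ → ℝ}

lemma gram_isPositive (T : X →L[𝕜] Y) : (gram T).IsPositive :=
  ContinuousLinearMap.isPositive_adjoint_comp_self T

/-- `‖T f(T* T) w‖ = ‖(√λ f)(T* T) w‖`, the isometry of the polar decomposition. -/
lemma norm_apply_opFun_gram (hf : ContinuousOn f (Icc 0 ‖gram T‖)) (w : X) :
    ‖T (opFun (gram T) f w)‖ = ‖opFun (gram T) (fun l => √l * f l) w‖ := by
  have hA := gram_isPositive T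
  have hsq : ContinuousOn (fun l : ℝ => √l) (Icc 0 ‖gram T‖) := Real.continuous_sqrt.continuousOn
  rw [← sq_eq_sq₀ (norm_nonneg _) (norm_nonneg _), opFun_mul hA hsq hf, mul_apply_eq_comp,
    ← re_inner_opFun_mul_self hA hsq, opFun_congr (g := fun l => l) hA (hsq.fun_mul hsq)
      fun l hl => Real.mul_self_sqrt hl.1, opFun_id hA, gram, ContinuousLinearMap.comp_apply,
    ContinuousLinearMap.adjoint_inner_left, inner_self_eq_norm_sq]

/-- `‖g(T* T) T*‖ = ‖T g(T* T)‖ ≤ sup √λ |g|`: propagation of the data noise. -/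
lemma norm_opFun_gram_adjoint_apply_le (hf : ContinuousOn f (Icc 0 ‖gram T‖)) {K : ℝ}
    (hK : ∀ l ∈ Icc 0 ‖gram T‖, |√l * f l| ≤ K) (y : Y) :
    ‖opFun (gram T) f (T.adjoint y)‖ ≤ K * ‖y‖ := by
  have hA := gram_isPositive T
  have hs : (opFun (gram T) f).adjoint = opFun (gram T) f := isSelfAdjoint_opFun hA hf
  have hc : ContinuousOn (fun l : ℝ => √l * f l) (Icc 0 ‖gram T‖) :=
    Real.continuous_sqrt.continuousOn.mul hf
  have hK0 : 0 ≤ K := (abs_nonneg _).trans (hK 0 ⟨le_rfl, norm_nonneg _⟩)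
  have h1 : ‖T ∘L opFun (gram T) f‖ ≤ K := by
    refine ContinuousLinearMap.opNorm_le_bound _ hK0 fun w => ?_
    rw [ContinuousLinearMap.comp_apply, norm_apply_opFun_gram hf]
    exact ContinuousLinearMap.le_of_opNorm_le _ (norm_opFun_le hA hc hK) w
  have h2 : (T ∘L opFun (gram T) f).adjoint y = opFun (gram T) f (T.adjoint y) := by
    rw [ContinuousLinearMap.adjoint_comp, hs, ContinuousLinearMap.comp_apply]
  rw [← h2]
  refine ContinuousLinearMap.le_of_opNorm_le _ ?_ y
  rwa [LinearIsometryEquiv.norm_map]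

/-- The residual operator `1 - T g(T* T) T*` is a contraction if `0 ≤ g` and `λ g ≤ 1`. -/
lemma norm_sub_apply_opFun_adjoint_le (hf : ContinuousOn f (Icc 0 ‖gram T‖))
    (h0 : ∀ l ∈ Icc 0 ‖gram T‖, 0 ≤ f l) (h1 : ∀ l ∈ Icc 0 ‖gram T‖, l * f l ≤ 1) (z : Y) :
    ‖z - T (opFun (gram T) f (T.adjoint z))‖ ≤ ‖z‖ := by
  have hA := gram_isPositive T
  set u := T.adjoint z with hu
  have hc : ContinuousOn (fun l : ℝ => √l * f l) (Icc 0 ‖gram T‖) :=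
    Real.continuous_sqrt.continuousOn.mul hf
  have e1 : RCLike.re (inner 𝕜 z (T (opFun (gram T) f u))) =
      RCLike.re (inner 𝕜 (opFun (gram T) f u) u) := by
    rw [← ContinuousLinearMap.adjoint_inner_left, ← hu, ← inner_conj_symm, RCLike.conj_re]
  have e2 : ‖T (opFun (gram T) f u)‖ ^ 2 ≤ RCLike.re (inner 𝕜 (opFun (gram T) f u) u) := by
    rw [norm_apply_opFun_gram hf, ← re_inner_opFun_mul_self hA hc]
    refine re_inner_opFun_mono hA (hc.fun_mul hc) hf (fun l hl => ?_) u
    have : √l * f l * (√l * f l) = l * f l * f l := by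
      rw [mul_mul_mul_comm, Real.mul_self_sqrt hl.1]; ring
    rw [this]
    exact mul_le_of_le_one_left (h0 l hl) (h1 l hl)
  have e3 : 0 ≤ RCLike.re (inner 𝕜 (opFun (gram T) f u) u) := (sq_nonneg _).trans e2
  rw [← sq_le_sq₀ (norm_nonneg _) (norm_nonneg _), @norm_sub_sq 𝕜, e1]
  linarith

/-- For exact data `T x`, the error is `(1 - λ g)(T* T) x`. -/
lemma sub_opFun_gram_adjoint_apply (hf : ContinuousOn f (Icc 0 ‖gram T‖)) (x : X) :
    x - opFun (gram T) f (T.adjoint (T x)) = opFun (gram T) (fun l => 1 - l * f l) x := by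
  have hA := gram_isPositive T
  have e : (fun l : ℝ => 1 - l * f l) = fun l => 1 - f l * l := by ext l; ring
  rw [e, opFun_sub hA continuousOn_const (hf.fun_mul (continuousOn_id' _)), opFun_one hA,
    opFun_mul (g := fun l => l) hA hf (continuousOn_id' _), opFun_id hA]
  rfl

end Gram

/-! ### The generator and index functions -/

section Generator

/-- The factor `λ^√α` of the generator function, extended to `α = ∞` by its limit `0`. -/
noncomputable def decayFun (α : ℝ≥0∞) (l : ℝ) : ℝ :=
  if α = ⊤ then 0 else l ^ √α.toReal

lemma genFun_eq (α : ℝ≥0∞) (l : ℝ) : genFun α l = 1 / (l + (1 - decayFun α l) ^ 2) := by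
  unfold genFun decayFun
  split_ifs <;> simp

lemma sqrt_toReal_pos {α : ℝ≥0∞} (h0 : 0 < α) (hα : α ≠ ⊤) : 0 < √α.toReal :=
  Real.sqrt_pos.2 (ENNReal.toReal_pos h0.ne' hα)

lemma decayFun_nonneg (α : ℝ≥0∞) {l : ℝ} (hl : 0 ≤ l) : 0 ≤ decayFun α l := by
  unfold decayFun
  split_ifs
  · exact le_rfl
  · exact Real.rpow_nonneg hl _

lemma rpow_le_exp_neg {l s : ℝ} (hl : l ∈ Icc 0 (Real.exp (-1))) (hs : 0 ≤ s) :
    l ^ s ≤ Real.exp (-s) := by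
  refine (Real.rpow_le_rpow hl.1 hl.2 hs).trans_eq ?_
  rw [← Real.exp_mul]
  ring_nf

lemma exists_decayFun_le {α : ℝ≥0∞} (h0 : 0 < α) :
    ∃ c < 1, 0 ≤ c ∧ ∀ l ∈ Icc 0 (Real.exp (-1)), decayFun α l ≤ c := by
  by_cases hα : α = ⊤
  · exact ⟨0, one_pos, le_rfl, fun l _ => by simp [decayFun, hα]⟩
  · have hs := sqrt_toReal_pos h0 hα
    refine ⟨Real.exp (-√α.toReal), by simpa using hs, (Real.exp_pos _).le, fun l hl => ?_⟩
    rw [decayFun, if_neg hα]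
    exact rpow_le_exp_neg hl hs.le

lemma decayFun_lt_one {α : ℝ≥0∞} (h0 : 0 < α) {l : ℝ} (hl : l ∈ Icc 0 (Real.exp (-1))) :
    decayFun α l < 1 := by
  obtain ⟨c, hc, -, h⟩ := exists_decayFun_le h0
  exact (h l hl).trans_lt hc

lemma denom_pos {α : ℝ≥0∞} (h0 : 0 < α) {l : ℝ} (hl : l ∈ Icc 0 (Real.exp (-1))) :
    0 < l + (1 - decayFun α l) ^ 2 := by
  have := sub_pos.2 (decayFun_lt_one h0 hl)
  have := hl.1
  positivity

lemma continuousOn_genFun {α : ℝ≥0∞} (h0 : 0 < α) {M : ℝ} (hM : M ≤ Real.exp (-1)) :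
    ContinuousOn (genFun α) (Icc 0 M) := by
  have hsub : Icc 0 M ⊆ Icc 0 (Real.exp (-1)) := Icc_subset_Icc_right hM
  have hd : Continuous (decayFun α) := by
    unfold decayFun
    split_ifs
    · exact continuous_const
    · exact Real.continuous_rpow_const (Real.sqrt_nonneg _)
  rw [show genFun α = fun l => 1 / (l + (1 - decayFun α l) ^ 2) from funext (genFun_eq α)]
  exact continuousOn_const.div (by fun_prop) fun l hl => (denom_pos h0 (hsub hl)).ne'

lemma genFun_nonneg {α : ℝ≥0∞} (h0 : 0 < α) {l : ℝ} (hl : l ∈ Icc 0 (Real.exp (-1))) :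
    0 ≤ genFun α l := by
  rw [genFun_eq]
  exact one_div_nonneg.2 (denom_pos h0 hl).le

/-- The residual function `r_α = 1 - λ g_α`. -/
noncomputable def resFun (α : ℝ≥0∞) (l : ℝ) : ℝ := 1 - l * genFun α l

lemma resFun_eq {α : ℝ≥0∞} (h0 : 0 < α) {l : ℝ} (hl : l ∈ Icc 0 (Real.exp (-1))) :
    resFun α l = (1 - decayFun α l) ^ 2 / (l + (1 - decayFun α l) ^ 2) := by
  have := (denom_pos h0 hl).ne'
  rw [resFun, genFun_eq]
  field_simp
  ring

lemma resFun_nonneg {α : ℝ≥0∞} (h0 : 0 < α) {l : ℝ} (hl : l ∈ Icc 0 (Real.exp (-1))) :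
    0 ≤ resFun α l := by
  rw [resFun_eq h0 hl]
  exact div_nonneg (sq_nonneg _) (denom_pos h0 hl).le

lemma mul_genFun_le_one {α : ℝ≥0∞} (h0 : 0 < α) {l : ℝ} (hl : l ∈ Icc 0 (Real.exp (-1))) :
    l * genFun α l ≤ 1 := by
  have := resFun_nonneg h0 hl
  rw [resFun] at this
  linarith

lemma resFun_le_one {α : ℝ≥0∞} (h0 : 0 < α) {l : ℝ} (hl : l ∈ Icc 0 (Real.exp (-1))) :
    resFun α l ≤ 1 := by
  have := mul_nonneg hl.1 (genFun_nonneg h0 hl)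
  rw [resFun]
  linarith

lemma continuousOn_resFun {α : ℝ≥0∞} (h0 : 0 < α) {M : ℝ} (hM : M ≤ Real.exp (-1)) :
    ContinuousOn (resFun α) (Icc 0 M) :=
  continuousOn_const.sub (continuousOn_id.mul (continuousOn_genFun h0 hM))

lemma sqrt_mul_one_sub_decayFun_le {α : ℝ≥0∞} {l : ℝ} (hl : 0 ≤ l) :
    √l * (1 - decayFun α l) ≤ l + (1 - decayFun α l) ^ 2 := by
  nlinarith [Real.sq_sqrt hl, sq_nonneg (√l - (1 - decayFun α l)), sq_nonneg √l,
    sq_nonneg (1 - decayFun α l)]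

lemma abs_sqrt_mul_genFun_le {α : ℝ≥0∞} (h0 : 0 < α) {l : ℝ} (hl : l ∈ Icc 0 (Real.exp (-1)))
    {c : ℝ} (hc : c < 1) (hdc : decayFun α l ≤ c) : |√l * genFun α l| ≤ 1 / (1 - c) := by
  rw [abs_of_nonneg (mul_nonneg (Real.sqrt_nonneg _) (genFun_nonneg h0 hl)), genFun_eq,
    mul_one_div, div_le_div_iff₀ (denom_pos h0 hl) (by linarith), one_mul]
  refine le_trans ?_ (sqrt_mul_one_sub_decayFun_le hl.1)
  exact mul_le_mul_of_nonneg_left (by linarith) (Real.sqrt_nonneg _)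

/-- With `u = -ln λ` this is `u³ ≤ 48 exp(u / 2)`, from the cubic term of the exponential series. -/
lemma sqrt_mul_neg_log_pow_le {l : ℝ} (h0 : 0 < l) (h1 : l ≤ 1) :
    √l * (-Real.log l) ^ 3 ≤ 48 := by
  have hL : 0 ≤ -Real.log l := by linarith [Real.log_nonpos h0.le h1]
  have h2 := Real.pow_div_factorial_le_exp (-Real.log l / 2) (by positivity) 3
  have h3 : √l * Real.exp (-Real.log l / 2) = 1 := by
    rw [Real.sqrt_eq_rpow, Real.rpow_def_of_pos h0, ← Real.exp_add]
    ring_nf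
    exact Real.exp_zero
  have h4 := mul_le_mul_of_nonneg_left h2 (Real.sqrt_nonneg l)
  rw [h3] at h4
  norm_num [Nat.factorial] at h4
  linarith [show √l * (-(Real.log l) / 2) ^ 3 / 6 = √l * (-Real.log l) ^ 3 / 48 by ring,
    show √l * ((-(Real.log l) / 2) ^ 3 / 6) = √l * (-Real.log l) ^ 3 / 48 by ring]

/-- `√λ r_α(λ)` is at most `√λ` and at most `1 - λ^√α ≤ √α (-ln λ)`. The weights `1/4` and `3/4`
of the two bounds are such that the resulting rate `α^(3/8)` is better than `α^(1/4)`. -/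
lemma sqrt_mul_resFun_pow_le {α : ℝ≥0∞} (h0 : 0 < α) (hα : α ≠ ⊤) {l : ℝ}
    (hl : l ∈ Icc 0 (Real.exp (-1))) : (√l * resFun α l) ^ 4 ≤ 48 * √α.toReal ^ 3 := by
  set s := √α.toReal with hs
  have hs0 : 0 < s := sqrt_toReal_pos h0 hα
  rcases hl.1.eq_or_lt with rfl | hl0
  · rw [Real.sqrt_zero, zero_mul, zero_pow (by norm_num)]
    positivity
  have hl1 : l ≤ 1 := hl.2.trans (by simp)
  have hb : 0 ≤ 1 - decayFun α l := sub_nonneg.2 (decayFun_lt_one h0 hl).le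
  have hL : 0 ≤ -Real.log l := by linarith [Real.log_nonpos hl.1 hl1]
  have hv0 : 0 ≤ √l * resFun α l := mul_nonneg (Real.sqrt_nonneg _) (resFun_nonneg h0 hl)
  have h1 : √l * resFun α l ≤ √l :=
    mul_le_of_le_one_right (Real.sqrt_nonneg _) (resFun_le_one h0 hl)
  have h2 : √l * resFun α l ≤ 1 - decayFun α l := by
    rw [resFun_eq h0 hl, ← mul_div_assoc, div_le_iff₀ (denom_pos h0 hl)]
    nlinarith [mul_le_mul_of_nonneg_left (sqrt_mul_one_sub_decayFun_le (α := α) hl.1) hb]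
  have h3 : 1 - decayFun α l ≤ s * (-Real.log l) := by
    rw [decayFun, if_neg hα, Real.rpow_def_of_pos hl0]
    linarith [Real.add_one_le_exp (Real.log l * √α.toReal)]
  calc (√l * resFun α l) ^ 4 = (√l * resFun α l) * (√l * resFun α l) ^ 3 := by ring
    _ ≤ √l * (s * (-Real.log l)) ^ 3 :=
        mul_le_mul h1 (pow_le_pow_left₀ hv0 (h2.trans h3) 3) (by positivity) (by positivity)
    _ = s ^ 3 * (√l * (-Real.log l) ^ 3) := by ring
    _ ≤ s ^ 3 * 48 := by
        gcongr
        exact sqrt_mul_neg_log_pow_le hl0 hl1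
    _ = 48 * s ^ 3 := by ring

/-- The generator is Lipschitz in the factor `λ^√α` as long as that factor stays away from `1`. -/
lemma abs_genFun_sub_le {α β : ℝ≥0∞} {l c : ℝ} (hl : 0 ≤ l) (hc : c < 1)
    (hα : decayFun α l ≤ c) (hβ : decayFun β l ≤ c) :
    |genFun β l - genFun α l| ≤ 2 / (1 - c) ^ 4 * |decayFun β l - decayFun α l| := by
  rw [genFun_eq, genFun_eq]
  have ha0 := decayFun_nonneg α hl
  have hb0 := decayFun_nonneg β hl
  set a := decayFun α l
  set b := decayFun β l
  have hc' : 0 < 1 - c := by linarith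
  have hDa : (1 - c) ^ 2 ≤ l + (1 - a) ^ 2 := by nlinarith
  have hDb : (1 - c) ^ 2 ≤ l + (1 - b) ^ 2 := by nlinarith
  have hDa0 : 0 < l + (1 - a) ^ 2 := lt_of_lt_of_le (by positivity) hDa
  have hDb0 : 0 < l + (1 - b) ^ 2 := lt_of_lt_of_le (by positivity) hDb
  have e : 1 / (l + (1 - b) ^ 2) - 1 / (l + (1 - a) ^ 2) =
      ((b - a) * (2 - a - b)) / ((l + (1 - b) ^ 2) * (l + (1 - a) ^ 2)) := by
    field_simp
    ring
  rw [e, abs_div, abs_mul, abs_of_pos (mul_pos hDb0 hDa0)]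
  have h1 : |2 - a - b| ≤ 2 := by rw [abs_le]; constructor <;> linarith
  calc |b - a| * |2 - a - b| / ((l + (1 - b) ^ 2) * (l + (1 - a) ^ 2))
      ≤ |b - a| * 2 / ((1 - c) ^ 2 * (1 - c) ^ 2) := by gcongr
    _ = 2 / (1 - c) ^ 4 * |b - a| := by ring

lemma rpow_sub_rpow_le {l s t : ℝ} (hl : l ∈ Icc 0 (Real.exp (-1))) (hs : 0 < s) (hst : s ≤ t) :
    |l ^ s - l ^ t| ≤ (t - s) / s := by
  have ht : 0 < t := hs.trans_le hst
  rcases hl.1.eq_or_lt with rfl | hl0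
  · rw [Real.zero_rpow hs.ne', Real.zero_rpow ht.ne', sub_self, abs_zero]
    exact div_nonneg (sub_nonneg.2 hst) hs.le
  have hl1 : l ≤ 1 := hl.2.trans (by simp)
  have hL : 0 ≤ -Real.log l := by linarith [Real.log_nonpos hl.1 hl1]
  rw [abs_of_nonneg (sub_nonneg.2 (Real.rpow_le_rpow_of_exponent_ge hl0 hl1 hst)),
    le_div_iff₀ hs]
  have e1 : l ^ t = l ^ s * l ^ (t - s) := by rw [← Real.rpow_add hl0]; ring_nf
  have e2 : 1 - l ^ (t - s) ≤ (t - s) * (-Real.log l) := by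
    rw [Real.rpow_def_of_pos hl0]
    linarith [Real.add_one_le_exp (Real.log l * (t - s))]
  have e3 : l ^ s * (s * (-Real.log l)) ≤ 1 := by
    have h := Real.add_one_le_exp (s * (-Real.log l))
    have h' : l ^ s * Real.exp (s * (-Real.log l)) = 1 := by
      rw [Real.rpow_def_of_pos hl0, ← Real.exp_add]
      ring_nf
      exact Real.exp_zero
    nlinarith [mul_le_mul_of_nonneg_left h (Real.rpow_nonneg hl.1 s), Real.rpow_nonneg hl.1 s]
  have h0 := Real.rpow_nonneg hl.1 s
  calc (l ^ s - l ^ t) * s = l ^ s * (1 - l ^ (t - s)) * s := by rw [e1]; ring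
    _ ≤ l ^ s * ((t - s) * (-Real.log l)) * s := by gcongr
    _ = (t - s) * (l ^ s * (s * (-Real.log l))) := by ring
    _ ≤ (t - s) * 1 := mul_le_mul_of_nonneg_left e3 (sub_nonneg.2 hst)
    _ = t - s := mul_one _

/-- `β → α` makes `λ^√β` converge to `λ^√α` uniformly on `[0, 1/e]`, also for `α = ∞`. -/
lemma exists_decayFun_modulus {α : ℝ≥0∞} (h0 : 0 < α) :
    ∃ e : ℝ≥0∞ → ℝ, Tendsto e (𝓝[Ioo 0 ⊤] α) (𝓝 0) ∧
      ∀ β ∈ Ioo 0 (⊤ : ℝ≥0∞), ∀ l ∈ Icc 0 (Real.exp (-1)),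
        |decayFun β l - decayFun α l| ≤ e β := by
  by_cases hα : α = ⊤
  · subst hα
    refine ⟨fun β => Real.exp (-√β.toReal), ?_, fun β hβ l hl => ?_⟩
    · have h1 : Tendsto ENNReal.toReal (𝓝[Ioo 0 ⊤] ⊤) atTop := by
        refine tendsto_atTop.2 fun b => ?_
        filter_upwards [self_mem_nhdsWithin,
          mem_nhdsWithin_of_mem_nhds (lt_mem_nhds (ENNReal.ofReal_lt_top (r := b)))] with β hβ hb
        exact (ENNReal.ofReal_le_iff_le_toReal hβ.2.ne).1 hb.le
      exact Real.tendsto_exp_neg_atTop_nhds_zero.comp (Real.tendsto_sqrt_atTop.comp h1)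
    · rw [decayFun, decayFun, if_neg hβ.2.ne, if_pos rfl, sub_zero,
        abs_of_nonneg (Real.rpow_nonneg hl.1 _)]
      exact rpow_le_exp_neg hl (Real.sqrt_nonneg _)
  · have hs := sqrt_toReal_pos h0 hα
    refine ⟨fun β => |√β.toReal - √α.toReal| / min √β.toReal √α.toReal, ?_, fun β hβ l hl => ?_⟩
    · have h1 : Tendsto (fun β : ℝ≥0∞ => √β.toReal) (𝓝[Ioo 0 ⊤] α) (𝓝 √α.toReal) :=
        (Real.continuous_sqrt.tendsto _).comp
          ((ENNReal.tendsto_toReal hα).mono_left nhdsWithin_le_nhds)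
      have h2 := ((h1.sub_const √α.toReal).abs).div (h1.min (tendsto_const_nhds (x := √α.toReal)))
        (by rw [min_self]; exact hs.ne')
      rwa [sub_self, abs_zero, zero_div] at h2
    · have ht := sqrt_toReal_pos hβ.1 hβ.2.ne
      rw [decayFun, decayFun, if_neg hβ.2.ne, if_neg hα]
      dsimp only
      rcases le_total √β.toReal √α.toReal with h | h
      · rw [min_eq_left h, abs_sub_comm √β.toReal, abs_of_nonneg (sub_nonneg.2 h)]
        exact rpow_sub_rpow_le hl ht h
      · rw [min_eq_right h, abs_of_nonneg (sub_nonneg.2 h), abs_sub_comm]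
        exact rpow_sub_rpow_le hl hs h

end Generator

section IndexFunction

lemma one_le_neg_log {l : ℝ} (h0 : 0 < l) (h1 : l ≤ Real.exp (-1)) : 1 ≤ -Real.log l := by
  have := (Real.log_le_iff_le_exp h0).2 h1
  linarith

lemma logFun_zero {p : ℝ} (hp : 0 < p) : logFun p 0 = 0 := by
  rw [logFun, Real.log_zero, neg_zero, Real.zero_rpow (neg_ne_zero.2 hp.ne')]

lemma continuousOn_logFun {p : ℝ} (hp : 0 < p) {M : ℝ} (hM : M ≤ Real.exp (-1)) :
    ContinuousOn (logFun p) (Icc 0 M) := by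
  intro l hl
  refine ContinuousAt.continuousWithinAt ?_
  rcases hl.1.eq_or_lt with rfl | hl0
  · rw [continuousAt_iff_punctured_nhds, logFun_zero hp]
    exact (tendsto_rpow_neg_atTop hp).comp
      (tendsto_neg_atBot_atTop.comp Real.tendsto_log_nhdsNE_zero)
  · have := one_le_neg_log hl0 (hl.2.trans hM)
    exact (Real.continuousAt_log hl0.ne').neg.rpow_const
      (Or.inl (by rw [Pi.neg_apply]; linarith))

lemma logFun_nonneg {p l : ℝ} (hl : l ∈ Icc 0 (Real.exp (-1))) : 0 ≤ logFun p l := by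
  have : l ≤ 1 := hl.2.trans (by simp)
  exact Real.rpow_nonneg (by linarith [Real.log_nonpos hl.1 this]) _

lemma logFun_le_of_le {p l ε : ℝ} (hp : 0 < p) (hl : 0 ≤ l) (hle : l ≤ ε)
    (hε : ε ≤ Real.exp (-1)) : logFun p l ≤ logFun p ε := by
  rcases hl.eq_or_lt with rfl | hl0
  · rw [logFun_zero hp]
    exact logFun_nonneg ⟨hle, hε⟩
  · have h1 := one_le_neg_log (hl0.trans_le hle) hε
    refine Real.rpow_le_rpow_of_nonpos (by linarith) ?_ (by linarith)
    linarith [Real.log_le_log hl0 hle]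

lemma logFun_le_one {p l : ℝ} (hp : 0 < p) (hl : l ∈ Icc 0 (Real.exp (-1))) : logFun p l ≤ 1 := by
  refine (logFun_le_of_le hp hl.1 hl.2 le_rfl).trans_eq ?_
  rw [logFun, Real.log_exp, neg_neg, Real.one_rpow]

lemma logFun_sqrt {p δ : ℝ} (h0 : 0 < δ) (h1 : δ ≤ 1) : logFun p √δ = 2 ^ p * logFun p δ := by
  have hL : 0 ≤ -Real.log δ := by linarith [Real.log_nonpos h0.le h1]
  rw [logFun, logFun, Real.log_sqrt h0.le, ← neg_div, Real.div_rpow hL (by norm_num),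
    Real.rpow_neg (by norm_num : (0 : ℝ) ≤ 2), div_inv_eq_mul, mul_comm]

/-- Every positive power of `δ` is negligible against `f_p(δ)`. -/
lemma rpow_isLittleO_logFun (p : ℝ) {a : ℝ} (ha : 0 < a) :
    (fun δ : ℝ => δ ^ a) =o[𝓝[>] 0] logFun p := by
  have h1 := isLittleO_abs_log_rpow_rpow_nhdsGT_zero p (neg_lt_zero.2 ha)
  have h2 := h1.inv_rev (by
    filter_upwards [Ioo_mem_nhdsGT (show (0 : ℝ) < Real.exp (-1) by positivity)] with δ hδ h
    have := one_le_neg_log hδ.1 hδ.2.le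
    have h3 : 0 < |Real.log δ| := abs_pos.2 (by linarith)
    exact absurd h (Real.rpow_pos_of_pos h3 _).ne')
  refine h2.congr' ?_ ?_
  · filter_upwards [self_mem_nhdsWithin] with δ hδ
    rw [Real.rpow_neg (le_of_lt hδ), inv_inv]
  · filter_upwards [Ioo_mem_nhdsGT (show (0 : ℝ) < Real.exp (-1) by positivity)] with δ hδ
    have := one_le_neg_log hδ.1 hδ.2.le
    rw [logFun, Real.rpow_neg (by linarith), abs_of_nonpos (by linarith)]

/-- `f_p(δ)` and `f_p(δ² / ρ²)` are of the same order. -/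
lemma eventually_logFun_le (p : ℝ) {ρ : ℝ} (hp : 0 < p) (hρ : 0 < ρ) :
    ∀ᶠ δ in 𝓝[>] (0 : ℝ), logFun p δ ≤ 3 ^ p * logFun p (δ ^ 2 / ρ ^ 2) := by
  have hlog : Tendsto (fun δ : ℝ => -Real.log δ) (𝓝[>] 0) atTop :=
    tendsto_neg_atBot_atTop.comp Real.tendsto_log_nhdsGT_zero
  filter_upwards [self_mem_nhdsWithin, hlog.eventually_ge_atTop (2 * |Real.log ρ|),
    hlog.eventually_gt_atTop (-2 * Real.log ρ), hlog.eventually_gt_atTop 0] with δ hδ h1 h2 h3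
  have hδ0 : 0 < δ := hδ
  have e : -Real.log (δ ^ 2 / ρ ^ 2) = 2 * (-Real.log δ) + 2 * Real.log ρ := by
    rw [Real.log_div (by positivity) (by positivity), Real.log_pow, Real.log_pow]
    push_cast
    ring
  have h4 := le_abs_self (Real.log ρ)
  rw [logFun, logFun, e]
  have h5 : (3 * (-Real.log δ)) ^ (-p) ≤ (2 * (-Real.log δ) + 2 * Real.log ρ) ^ (-p) :=
    Real.rpow_le_rpow_of_nonpos (by linarith) (by linarith) (by linarith)
  calc (-Real.log δ) ^ (-p) = 3 ^ p * (3 * (-Real.log δ)) ^ (-p) := by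
        rw [Real.mul_rpow (by norm_num) h3.le, ← mul_assoc, ← Real.rpow_add (by norm_num)]
        simp
    _ ≤ _ := by gcongr

end IndexFunction

/-! ### The discrepancy principle -/

section Discrepancy

variable {𝕜 X Y : Type*} [RCLike 𝕜]
  [NormedAddCommGroup X] [InnerProductSpace 𝕜 X] [CompleteSpace X]
  [NormedAddCommGroup Y] [InnerProductSpace 𝕜 Y] [CompleteSpace Y]
  {T : X →L[𝕜] Y} {p ρ δ : ℝ} {α : ℝ≥0∞}

/-- Norm continuity of `α ↦ g_α(T* T)`, up to and including `α = ∞`. -/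
lemma tendsto_opFun_genFun (hT : ‖gram T‖ ≤ Real.exp (-1)) (h0 : 0 < α) :
    Tendsto (fun β => opFun (gram T) (genFun β)) (𝓝[Ioo 0 ⊤] α)
      (𝓝 (opFun (gram T) (genFun α))) := by
  have hA := gram_isPositive T
  obtain ⟨c, hc, hc0, hcα⟩ := exists_decayFun_le h0
  obtain ⟨e, he, hemod⟩ := exists_decayFun_modulus h0
  set c' := (1 + c) / 2 with hc'
  rw [tendsto_iff_norm_sub_tendsto_zero]
  refine squeeze_zero' (g := fun β => 2 / (1 - c') ^ 4 * e β)
    (Eventually.of_forall fun _ => norm_nonneg _) ?_ (by simpa using he.const_mul _)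
  filter_upwards [self_mem_nhdsWithin, he.eventually (gt_mem_nhds (show 0 < c' - c by linarith))]
    with β hβ hlt
  have hcβ := continuousOn_genFun hβ.1 hT
  have hcα' := continuousOn_genFun h0 hT
  rw [← opFun_sub hA hcβ hcα']
  refine norm_opFun_le hA (hcβ.sub hcα') fun l hl => ?_
  have hl' : l ∈ Icc 0 (Real.exp (-1)) := Icc_subset_Icc_right hT hl
  have h1 := hemod β hβ l hl'
  have h2 := hcα l hl'
  have h3 := (abs_le.1 h1).2
  refine (abs_genFun_sub_le (c := c') hl.1 (by linarith) (by linarith) (by linarith)).trans ?_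
  gcongr

/-- The residual splits into the residual operator applied to the noise and the residual of the
exact data. -/
lemma sub_apply_regSol (hT : ‖gram T‖ ≤ Real.exp (-1)) (h0 : 0 < α) (x : X) (y : Y) :
    y - T (regSol T α y) = ((y - T x) - T (opFun (gram T) (genFun α) (T.adjoint (y - T x)))) +
      T (opFun (gram T) (resFun α) x) := by
  have h := sub_opFun_gram_adjoint_apply (continuousOn_genFun h0 hT) x
  change _ = opFun (gram T) (resFun α) x at h
  rw [← h, regSol]
  simp only [map_sub]
  abel

lemma norm_residual_noise_le (hT : ‖gram T‖ ≤ Real.exp (-1)) (h0 : 0 < α) (z : Y) :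
    ‖z - T (opFun (gram T) (genFun α) (T.adjoint z))‖ ≤ ‖z‖ :=
  have hsub : Icc 0 ‖gram T‖ ⊆ Icc 0 (Real.exp (-1)) := Icc_subset_Icc_right hT
  norm_sub_apply_opFun_adjoint_le (continuousOn_genFun h0 hT)
    (fun _ hl => genFun_nonneg h0 (hsub hl)) (fun _ hl => mul_genFun_le_one h0 (hsub hl)) z

lemma norm_apply_resFun_le (hT : ‖gram T‖ ≤ Real.exp (-1)) (hp : 0 < p) (h0 : 0 < α)
    (hα : α ≠ ⊤) (w : X) :
    ‖T (opFun (gram T) (resFun α) (opFun (gram T) (logFun p) w))‖ ≤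
      √√(48 * √α.toReal ^ 3) * ‖w‖ := by
  have hA := gram_isPositive T
  have hr := continuousOn_resFun h0 hT
  have hF := continuousOn_logFun hp hT
  rw [← mul_apply_eq_comp, ← opFun_mul hA hr hF, norm_apply_opFun_gram (hr.fun_mul hF)]
  refine ContinuousLinearMap.le_of_opNorm_le _ (norm_opFun_le hA
    (Real.continuous_sqrt.continuousOn.fun_mul (hr.fun_mul hF)) fun l hl => ?_) w
  have hl' : l ∈ Icc 0 (Real.exp (-1)) := Icc_subset_Icc_right hT hl
  have hr0 := resFun_nonneg h0 hl'
  have hF0 := logFun_nonneg (p := p) hl'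
  have h1 : √l * resFun α l ≤ √√(48 * √α.toReal ^ 3) := by
    refine Real.le_sqrt_of_sq_le (Real.le_sqrt_of_sq_le ?_)
    rw [← pow_mul]
    exact sqrt_mul_resFun_pow_le h0 hα hl'
  rw [abs_of_nonneg (by positivity), ← mul_assoc]
  exact (mul_le_of_le_one_right (by positivity) (logFun_le_one hp hl')).trans h1

/-- The second term tends to `0` with `α`, so small parameters satisfy the discrepancy inequality,
and a parameter violating it cannot be small. -/
lemma norm_residual_le (hT : ‖gram T‖ ≤ Real.exp (-1)) (hp : 0 < p) (h0 : 0 < α) (hα : α ≠ ⊤)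
    {x : X} (hx : x ∈ sourceSet T p ρ) {y : Y} (hy : ‖y - T x‖ ≤ δ) :
    ‖T (regSol T α y) - y‖ ≤ δ + √√(48 * √α.toReal ^ 3) * ρ := by
  obtain ⟨w, hw, rfl⟩ := hx
  rw [norm_sub_rev, sub_apply_regSol hT h0 (opFun (gram T) (logFun p) w)]
  refine (norm_add_le _ _).trans (add_le_add ((norm_residual_noise_le hT h0 _).trans hy) ?_)
  exact (norm_apply_resFun_le hT hp h0 hα w).trans (by gcongr)

lemma exists_discrepancy_le (hT : ‖gram T‖ ≤ Real.exp (-1)) (hp : 0 < p) (hδ : 0 < δ)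
    {x : X} (hx : x ∈ sourceSet T p ρ) {y : Y} (hy : ‖y - T x‖ ≤ δ) :
    {α : ℝ≥0∞ | 0 < α ∧ α < ⊤ ∧ ‖T (regSol T α y) - y‖ ≤ δ + √δ}.Nonempty := by
  have hc : Continuous fun s : ℝ => √√(48 * s ^ 3) * ρ := by fun_prop
  have h1 : ∀ᶠ s in 𝓝[>] (0 : ℝ), √√(48 * s ^ 3) * ρ < √δ := by
    refine nhdsWithin_le_nhds (hc.continuousAt.eventually (gt_mem_nhds ?_))
    simpa using hδ
  obtain ⟨s, hs, hs0⟩ := (h1.and self_mem_nhdsWithin).exists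
  have hs0 : 0 < s := hs0
  have hpos : 0 < ENNReal.ofReal (s ^ 2) := ENNReal.ofReal_pos.2 (by positivity)
  refine ⟨ENNReal.ofReal (s ^ 2), hpos, ENNReal.ofReal_lt_top, ?_⟩
  have h2 := norm_residual_le hT hp hpos ENNReal.ofReal_ne_top hx hy
  rw [ENNReal.toReal_ofReal (by positivity), Real.sqrt_sq hs0.le] at h2
  linarith

lemma paramChoice_pos (hT : ‖gram T‖ ≤ Real.exp (-1)) (hp : 0 < p) (hδ : 0 < δ)
    {x : X} (hx : x ∈ sourceSet T p ρ) {y : Y} (hy : ‖y - T x‖ ≤ δ) :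
    0 < paramChoice T δ y := by
  obtain ⟨α, hα⟩ := exists_discrepancy_le hT hp hδ hx hy
  exact hα.1.trans_le (le_sSup hα)

/-- By continuity in the parameter, the discrepancy inequality persists at the supremum. -/
lemma norm_residual_paramChoice_le (hT : ‖gram T‖ ≤ Real.exp (-1)) (hp : 0 < p) (hδ : 0 < δ)
    {x : X} (hx : x ∈ sourceSet T p ρ) {y : Y} (hy : ‖y - T x‖ ≤ δ) :
    ‖T (discrepancySol T δ y) - y‖ ≤ δ + √δ := by
  have hne := exists_discrepancy_le hT hp hδ hx hy
  set S := {α : ℝ≥0∞ | 0 < α ∧ α < ⊤ ∧ ‖T (regSol T α y) - y‖ ≤ δ + √δ} with hS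
  have hmem : paramChoice T δ y ∈ closure S := csSup_mem_closure hne (OrderTop.bddAbove S)
  have := mem_closure_iff_nhdsWithin_neBot.1 hmem
  have hsub : S ⊆ Ioo 0 ⊤ := fun α hα => ⟨hα.1, hα.2.1⟩
  have h1 := (tendsto_opFun_genFun hT (paramChoice_pos hT hp hδ hx hy)).mono_left
    (nhdsWithin_mono _ hsub)
  have h2 : Tendsto (fun β => ‖T (regSol T β y) - y‖) (𝓝[S] (paramChoice T δ y))
      (𝓝 ‖T (discrepancySol T δ y) - y‖) :=
    (((T.continuous.tendsto _).comp
      (((ContinuousLinearMap.apply 𝕜 X (T.adjoint y)).continuous.tendsto _).comp h1)).sub_const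
        y).norm
  exact le_of_tendsto h2 (eventually_mem_nhdsWithin.mono fun β hβ => hβ.2.2)

/-- A finite parameter is not too small: above the supremum the discrepancy exceeds `δ + √δ`, of
which at most `δ` is due to the noise. -/
lemma sq_le_of_paramChoice_ne_top (hT : ‖gram T‖ ≤ Real.exp (-1)) (hp : 0 < p) (hδ : 0 < δ)
    {x : X} (hx : x ∈ sourceSet T p ρ) {y : Y} (hy : ‖y - T x‖ ≤ δ)
    (htop : paramChoice T δ y ≠ ⊤) :
    δ ^ 2 ≤ 48 * √(paramChoice T δ y).toReal ^ 3 * ρ ^ 4 := by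
  set s := √(paramChoice T δ y).toReal with hs
  have hs0 : 0 ≤ s := Real.sqrt_nonneg _
  have hc : Continuous fun t : ℝ => √√(48 * t ^ 3) * ρ := by fun_prop
  have h1 : √δ ≤ √√(48 * s ^ 3) * ρ := by
    refine ge_of_tendsto (hc.continuousAt.mono_left nhdsWithin_le_nhds :
      Tendsto _ (𝓝[>] s) _) ?_
    filter_upwards [self_mem_nhdsWithin] with t ht
    have hst : s < t := ht
    have ht0 : 0 < t := hs0.trans_lt hst
    have hpos : 0 < ENNReal.ofReal (t ^ 2) := ENNReal.ofReal_pos.2 (by positivity)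
    have h2 := norm_residual_le hT hp hpos ENNReal.ofReal_ne_top hx hy
    rw [ENNReal.toReal_ofReal (by positivity), Real.sqrt_sq ht0.le] at h2
    have h3 : paramChoice T δ y < ENNReal.ofReal (t ^ 2) := by
      rw [ENNReal.lt_ofReal_iff_toReal_lt htop]
      exact (Real.sqrt_lt' ht0).1 hst
    by_contra! hlt
    exact h3.not_ge (le_sSup ⟨hpos, ENNReal.ofReal_lt_top, by linarith⟩)
  have h2 := pow_le_pow_left₀ (Real.sqrt_nonneg δ) h1 4
  have e1 : √δ ^ 4 = δ ^ 2 := by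
    rw [show √δ ^ 4 = (√δ ^ 2) ^ 2 by ring, Real.sq_sqrt hδ.le]
  have e2 : √√(48 * s ^ 3) ^ 4 = 48 * s ^ 3 := by
    rw [show √√(48 * s ^ 3) ^ 4 = (√√(48 * s ^ 3) ^ 2) ^ 2 by ring, Real.sq_sqrt (by positivity),
      Real.sq_sqrt (by positivity)]
  rwa [mul_pow, e1, e2] at h2

/-- Conditional stability under the logarithmic source condition. -/
lemma norm_sq_opFun_logFun_le (hT : ‖gram T‖ ≤ Real.exp (-1)) (hp : 0 < p) {ε : ℝ} (hε : 0 < ε)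
    (hε1 : ε ≤ Real.exp (-1)) (v : X) :
    ‖opFun (gram T) (logFun p) v‖ ^ 2 ≤
      (logFun p ε * ‖v‖) ^ 2 + ‖T (opFun (gram T) (logFun p) v)‖ ^ 2 / ε := by
  have hA := gram_isPositive T
  have hF := continuousOn_logFun hp hT
  have hsF : ContinuousOn (fun l => √l * logFun p l) (Icc 0 ‖gram T‖) :=
    Real.continuous_sqrt.continuousOn.fun_mul hF
  have hFε := logFun_nonneg (p := p) ⟨hε.le, hε1⟩
  have h1 := norm_sq_opFun_apply_le hA hF (g := fun _ => logFun p ε)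
    (h := fun l => 1 / √ε * (√l * logFun p l)) continuousOn_const
    (continuousOn_const.fun_mul hsF) (fun l hl => ?_) v
  · refine h1.trans (add_le_add (pow_le_pow_left₀ (norm_nonneg _) ?_ 2) ?_)
    · exact ContinuousLinearMap.le_of_opNorm_le _ (norm_opFun_le hA continuousOn_const
        fun l _ => (abs_of_nonneg hFε).le) v
    · rw [opFun_mul hA continuousOn_const hsF, mul_apply_eq_comp]
      have h2 : ‖opFun (gram T) (fun _ => 1 / √ε)‖ ≤ 1 / √ε :=
        norm_opFun_le hA continuousOn_const fun l _ => (abs_of_nonneg (by positivity)).le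
      have h3 := pow_le_pow_left₀ (norm_nonneg _) (ContinuousLinearMap.le_of_opNorm_le _ h2
        (opFun (gram T) (fun l => √l * logFun p l) v)) 2
      refine h3.trans_eq ?_
      rw [norm_apply_opFun_gram hF, mul_pow, div_pow, Real.sq_sqrt hε.le]
      ring
  -- below `ε` the first term dominates, above `ε` the factor `λ / ε` of the second exceeds `1`
  · have hl' : l ∈ Icc 0 (Real.exp (-1)) := Icc_subset_Icc_right hT hl
    have e : (1 / √ε * (√l * logFun p l)) ^ 2 = l / ε * logFun p l ^ 2 := by
      rw [mul_pow, mul_pow, div_pow, Real.sq_sqrt hε.le, Real.sq_sqrt hl.1]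
      ring
    rw [e]
    rcases le_total l ε with h | h
    · have h4 := pow_le_pow_left₀ (logFun_nonneg hl') (logFun_le_of_le hp hl.1 h hε1) 2
      have h5 : 0 ≤ l / ε * logFun p l ^ 2 := mul_nonneg (div_nonneg hl.1 hε.le) (sq_nonneg _)
      linarith
    · have h6 : 1 ≤ l / ε := (one_le_div hε).2 h
      nlinarith [sq_nonneg (logFun p l), sq_nonneg (logFun p ε)]

/-- The bias is again of the form `f_p(T* T) v` with `‖v‖ ≤ ρ`, and the discrepancy inequality makes
its image under `T` small. -/
lemma norm_bias_le (hT : ‖gram T‖ ≤ Real.exp (-1)) (hp : 0 < p) (hδ : 0 < δ)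
    (hδ1 : √δ ≤ Real.exp (-1)) (h0 : 0 < α) {x : X} (hx : x ∈ sourceSet T p ρ) {y : Y}
    (hy : ‖y - T x‖ ≤ δ) (hres : ‖T (regSol T α y) - y‖ ≤ δ + √δ) :
    ‖opFun (gram T) (resFun α) x‖ ≤ 2 ^ p * ρ * logFun p δ + 3 * √√δ := by
  have hA := gram_isPositive T
  have hr := continuousOn_resFun h0 hT
  have hF := continuousOn_logFun hp hT
  have hsδ : 0 < √δ := Real.sqrt_pos.2 hδ
  have hs1 : √δ ≤ 1 := hδ1.trans (by simp)
  have hδ1' : δ ≤ √δ := by nlinarith [Real.sq_sqrt hδ.le]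
  have hTr : ‖T (opFun (gram T) (resFun α) x)‖ ≤ 3 * √δ := by
    have h := sub_apply_regSol hT h0 x y
    have h1 := norm_residual_noise_le hT h0 (y - T x)
    have h2 := norm_sub_le (y - T (regSol T α y))
      ((y - T x) - T (opFun (gram T) (genFun α) (T.adjoint (y - T x))))
    rw [h, add_sub_cancel_left, ← h, norm_sub_rev y] at h2
    linarith
  obtain ⟨w, hw, rfl⟩ := hx
  have hcomm : opFun (gram T) (resFun α) (opFun (gram T) (logFun p) w) =
      opFun (gram T) (logFun p) (opFun (gram T) (resFun α) w) := by
    rw [← mul_apply_eq_comp, ← mul_apply_eq_comp, ← opFun_mul hA hr hF, ← opFun_mul hA hF hr]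
    simp only [mul_comm]
  rw [hcomm] at hTr ⊢
  have hv : ‖opFun (gram T) (resFun α) w‖ ≤ ρ := by
    refine (ContinuousLinearMap.le_of_opNorm_le _ (norm_opFun_le hA hr (K := 1)
      fun l hl => ?_) w).trans (by linarith)
    have hl' : l ∈ Icc 0 (Real.exp (-1)) := Icc_subset_Icc_right hT hl
    rw [abs_of_nonneg (resFun_nonneg h0 hl')]
    exact resFun_le_one h0 hl'
  have hst := norm_sq_opFun_logFun_le hT hp hsδ hδ1 (opFun (gram T) (resFun α) w)
  have hFs := logFun_nonneg (p := p) ⟨hsδ.le, hδ1⟩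
  have hb1 : logFun p √δ * ‖opFun (gram T) (resFun α) w‖ ≤ 2 ^ p * ρ * logFun p δ := by
    rw [mul_right_comm, ← logFun_sqrt hδ (hδ1'.trans hs1)]
    gcongr
  have hb2 : ‖T (opFun (gram T) (logFun p) (opFun (gram T) (resFun α) w))‖ ^ 2 / √δ ≤
      (3 * √√δ) ^ 2 := by
    rw [div_le_iff₀ hsδ, mul_pow, Real.sq_sqrt hsδ.le, mul_assoc, ← pow_two, ← mul_pow]
    exact pow_le_pow_left₀ (norm_nonneg _) hTr 2
  have hb0 : 0 ≤ logFun p √δ * ‖opFun (gram T) (resFun α) w‖ := by positivity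
  have hb3 := hb0.trans hb1
  refine abs_le_of_sq_le_sq' ?_ (by positivity) |>.2
  nlinarith [pow_le_pow_left₀ hb0 hb1 2, mul_nonneg hb3 (Real.sqrt_nonneg √δ)]

/-- The noise is at most `δ` for `α = ∞` and `δ + δ / √α` otherwise; the lower bound on the finite
parameter turns `(δ / √α)³` into at most `48 ρ⁴ δ`. -/
lemma norm_noise_le (hT : ‖gram T‖ ≤ Real.exp (-1)) (h0 : 0 < α) (hδ : 0 < δ) (hρ : 0 < ρ)
    (hα : α ≠ ⊤ → δ ^ 2 ≤ 48 * √α.toReal ^ 3 * ρ ^ 4) {z : Y} (hz : ‖z‖ ≤ δ) :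
    ‖opFun (gram T) (genFun α) (T.adjoint z)‖ ≤ δ + (48 * ρ ^ 4 * δ) ^ (1 / 3 : ℝ) := by
  have hsub : Icc 0 ‖gram T‖ ⊆ Icc 0 (Real.exp (-1)) := Icc_subset_Icc_right hT
  have hg := continuousOn_genFun h0 hT
  by_cases htop : α = ⊤
  · have h1 := norm_opFun_gram_adjoint_apply_le hg (K := 1) (fun l hl => by
      have := abs_sqrt_mul_genFun_le h0 (hsub hl) (c := 0) one_pos (by simp [decayFun, htop])
      simpa using this) z
    have : 0 ≤ (48 * ρ ^ 4 * δ) ^ (1 / 3 : ℝ) := by positivity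
    linarith
  · set s := √α.toReal with hs
    have hs0 : 0 < s := sqrt_toReal_pos h0 htop
    have hlt : Real.exp (-s) < 1 := by simpa using hs0
    have h1 := norm_opFun_gram_adjoint_apply_le hg (K := 1 / (1 - Real.exp (-s)))
      (fun l hl => abs_sqrt_mul_genFun_le h0 (hsub hl) hlt (by
        rw [decayFun, if_neg htop]
        exact rpow_le_exp_neg (hsub hl) hs0.le)) z
    have h2 : 1 / (1 - Real.exp (-s)) ≤ 1 + 1 / s := by
      rw [div_le_iff₀ (by linarith)]
      have h3 : Real.exp (-s) * (s + 1) ≤ 1 := by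
        calc Real.exp (-s) * (s + 1) ≤ Real.exp (-s) * Real.exp s := by
              gcongr
              exact Real.add_one_le_exp s
          _ = 1 := by rw [← Real.exp_add]; simp
      have h4 : (1 + 1 / s) * (1 - Real.exp (-s)) =
          1 + (1 - Real.exp (-s) * (s + 1)) / s := by field_simp; ring
      rw [h4]
      have := div_nonneg (sub_nonneg.2 h3) hs0.le
      linarith
    have h5 : δ / s ≤ (48 * ρ ^ 4 * δ) ^ (1 / 3 : ℝ) := by
      have h6 : (δ / s) ^ (3 : ℕ) ≤ 48 * ρ ^ 4 * δ := by
        rw [div_pow, div_le_iff₀ (by positivity)]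
        nlinarith [mul_le_mul_of_nonneg_left (hα htop) hδ.le]
      have h7 := Real.rpow_le_rpow (by positivity) h6 (by norm_num : (0 : ℝ) ≤ 1 / 3)
      rwa [← Real.rpow_natCast, ← Real.rpow_mul (by positivity), Nat.cast_ofNat,
        mul_one_div_cancel (by norm_num), Real.rpow_one] at h7
    calc _ ≤ 1 / (1 - Real.exp (-s)) * ‖z‖ := h1
      _ ≤ (1 + 1 / s) * δ := by gcongr
      _ = δ + δ / s := by ring
      _ ≤ _ := by linarith

lemma norm_sub_discrepancySol_le (hT : ‖gram T‖ ≤ Real.exp (-1)) (hp : 0 < p) (hρ : 0 < ρ)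
    (hδ : 0 < δ) (hδ1 : √δ ≤ Real.exp (-1)) {x : X} (hx : x ∈ sourceSet T p ρ) {y : Y}
    (hy : ‖y - T x‖ ≤ δ) :
    ‖x - discrepancySol T δ y‖ ≤ 2 ^ p * ρ * logFun p δ + 3 * √√δ +
      (δ + (48 * ρ ^ 4 * δ) ^ (1 / 3 : ℝ)) := by
  have h0 := paramChoice_pos hT hp hδ hx hy
  have hbias := norm_bias_le hT hp hδ hδ1 h0 hx hy
    (norm_residual_paramChoice_le hT hp hδ hx hy)
  have hnoise := norm_noise_le hT h0 hδ hρ (sq_le_of_paramChoice_ne_top hT hp hδ hx hy) hy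
  have e : x - discrepancySol T δ y = opFun (gram T) (resFun (paramChoice T δ y)) x -
      opFun (gram T) (genFun (paramChoice T δ y)) (T.adjoint (y - T x)) := by
    have h := sub_opFun_gram_adjoint_apply (continuousOn_genFun h0 hT) x
    change _ = opFun (gram T) (resFun (paramChoice T δ y)) x at h
    rw [← h, discrepancySol, regSol]
    simp only [map_sub]
    abel
  rw [e]
  exact (norm_sub_le _ _).trans (add_le_add hbias hnoise)

/-- The error bound, uniformly in the exact solution and the data. -/
lemma exists_norm_sub_discrepancySol_le (hT : ‖gram T‖ ≤ Real.exp (-1)) (hp : 0 < p)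
    (hρ : 0 < ρ) : ∃ K, ∀ᶠ δ in 𝓝[>] (0 : ℝ), ∀ x ∈ sourceSet T p ρ, ∀ y : Y,
      ‖y - T x‖ ≤ δ → ‖x - discrepancySol T δ y‖ ≤ K * logFun p δ := by
  have hO : (fun δ : ℝ => 2 ^ p * ρ * logFun p δ + 3 * δ ^ (1 / 4 : ℝ) +
      (δ ^ (1 : ℝ) + (48 * ρ ^ 4) ^ (1 / 3 : ℝ) * δ ^ (1 / 3 : ℝ))) =O[𝓝[>] 0] logFun p :=
    (((isBigO_refl _ _).const_mul_left _).add
      ((rpow_isLittleO_logFun p (by norm_num)).isBigO.const_mul_left _)).add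
      ((rpow_isLittleO_logFun p one_pos).isBigO.add
        ((rpow_isLittleO_logFun p (by norm_num)).isBigO.const_mul_left _))
  obtain ⟨K, hK⟩ := hO.bound
  have hsqrt : ∀ᶠ δ in 𝓝[>] (0 : ℝ), √δ < Real.exp (-1) := by
    refine nhdsWithin_le_nhds (Real.continuous_sqrt.continuousAt.eventually (gt_mem_nhds ?_))
    simpa using Real.exp_pos (-1)
  refine ⟨K, ?_⟩
  filter_upwards [hK, self_mem_nhdsWithin, hsqrt,
    Ioo_mem_nhdsGT (show (0 : ℝ) < Real.exp (-1) by positivity)] with δ h1 hδ h2 h3 x hx y hy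
  have hδ0 : 0 < δ := hδ
  rw [Real.norm_of_nonneg (logFun_nonneg ⟨h3.1.le, h3.2.le⟩)] at h1
  refine ((norm_sub_discrepancySol_le hT hp hρ hδ0 h2.le hx hy).trans_eq ?_).trans
    ((le_abs_self _).trans h1)
  rw [Real.sqrt_eq_rpow, Real.sqrt_eq_rpow, ← Real.rpow_mul hδ0.le, Real.rpow_one,
    Real.mul_rpow (by positivity) hδ0.le]
  norm_num

end Discrepancy
end LogReg

open LogReg in
theorem mainTheorem3 {𝕜 X Y : Type*} [RCLike 𝕜]
    [NormedAddCommGroup X] [InnerProductSpace 𝕜 X] [CompleteSpace X]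
    [NormedAddCommGroup Y] [InnerProductSpace 𝕜 Y] [CompleteSpace Y]
    (T : X →L[𝕜] Y) (hT : ‖LogReg.gram T‖ ≤ Real.exp (-1))
    (p ρ : ℝ) (hp : 0 < p) (hρ : 0 < ρ) :
    (∀ x ∈ LogReg.sourceSet T p ρ, ∀ δ : ℝ, 0 < δ → ∀ y : Y, ‖y - T x‖ ≤ δ →
      0 < LogReg.paramChoice T δ y) ∧
    (∀ x ∈ LogReg.sourceSet T p ρ, ∀ y : ℝ → Y, (∀ δ : ℝ, 0 < δ → ‖y δ - T x‖ ≤ δ) →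
      (fun δ : ℝ => ‖x - LogReg.discrepancySol T δ (y δ)‖) =O[𝓝[>] 0]
        fun δ : ℝ => LogReg.logFun p δ) ∧
    LogReg.IsOrderOptimalLog T p ρ (LogReg.discrepancySol T) := by
  obtain ⟨K, hK⟩ := exists_norm_sub_discrepancySol_le hT hp hρ
  refine ⟨fun x hx δ hδ y hy => paramChoice_pos hT hp hδ hx hy, fun x hx y hy => ?_, ?_⟩
  · refine IsBigO.of_bound |K| ?_
    filter_upwards [hK, self_mem_nhdsWithin] with δ h1 hδ
    rw [norm_norm]
    refine (h1 x hx (y δ) (hy δ hδ)).trans ((le_abs_self _).trans_eq ?_)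
    rw [abs_mul, Real.norm_eq_abs]
  · refine ⟨max 1 (|K| * 3 ^ p / ρ), le_max_left _ _, fun _ => 0, tendsto_const_nhds, ?_⟩
    filter_upwards [hK, eventually_logFun_le p hp hρ,
      Ioo_mem_nhdsGT (show (0 : ℝ) < Real.exp (-1) by positivity)] with δ h1 h2 h3
    refine iSup₂_le fun x hx => iSup₂_le fun y hy => ENNReal.ofReal_le_ofReal ?_
    have hF := logFun_nonneg (p := p) ⟨h3.1.le, h3.2.le⟩
    have hF' : 0 ≤ logFun p (δ ^ 2 / ρ ^ 2) :=
      nonneg_of_mul_nonneg_right (hF.trans h2) (by positivity)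
    rw [norm_sub_rev, add_zero, mul_one]
    calc ‖x - discrepancySol T δ y‖ ≤ K * logFun p δ := h1 x hx y hy
      _ ≤ |K| * (3 ^ p * logFun p (δ ^ 2 / ρ ^ 2)) :=
          mul_le_mul (le_abs_self K) h2 hF (abs_nonneg K)
      _ = |K| * 3 ^ p / ρ * ρ * logFun p (δ ^ 2 / ρ ^ 2) := by field_simp
      _ ≤ max 1 (|K| * 3 ^ p / ρ) * ρ * logFun p (δ ^ 2 / ρ ^ 2) := by
          gcongr
          exact le_max_right _ _
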